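/- Let $\mathcal C$ be a variety of universal algebras (single-sorted, finitary operations, defined by identities; algebras may be empty), regarded as a category with all homomorphisms. Let $F(X)$ denote the free algebra of $\mathcal C$ on the set $X$, so that $F(\emptyset)$ is the initial algebra; its elements are called constants. Suppose that $\mathcal C$ has a diagonalising term, that is, for some $k\ge 1$ there are a $(k+2)$-ary term $t$ and constants $e_1,\dots,e_k,e_1',\dots,e_k'\in F(\emptyset)$ such that the identities $$t(x,y,e_1,\dots,e_k)=x,\qquad t(x,y,e_1',\dots,e_k')=y$$ hold in $\mathcal C$. For a set $X$, let $\eta_X\colon F(X)+F(\emptyset)^2\to F(X)^2$ be the homomorphism $([\mathrm{id},\pi_1],[\mathrm{id},\pi_2])$ whose $i$-th component $[\mathrm{id},\pi_i]\colon F(X)+F(\emptyset)^2\to F(X)$ is the identity on $F(X)$ and, on $F(\emptyset)^2$, the projection $\pi_i\colon F(\emptyset)^2\to F(\emptyset)$ followed by the unique homomorphism $F(\emptyset)\to F(X)$. (Here $+$ is the coproduct in $\mathcal C$; $\eta_X$ is the component, at the coproduct inclusion $F(\emptyset)^2\to F(X)+F(\emptyset)^2$, of the unit of the adjunction between $\times\colon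 F(\emptyset)/\mathcal C\times F(\emptyset)/\mathcal C\to F(\emptyset)^2/\mathcal C$ and its left adjoint given by pushouts along the projections.) Then $\mathcal C$ is coextensive, i.e. for all objects $A,B$ of $\mathcal C$ the canonical functor $$\times\colon A/\mathcal C\times B/\mathcal C\to (A\times B)/\mathcal C,\qquad (f,g)\mapsto f\times g,$$ is an equivalence of categories, if and only if $\eta_X$ is an isomorphism for every set $X$. -/

import Mathlib

open CategoryTheory CategoryTheory.Limits FirstOrder FirstOrder.Language

universe u v w

/-! ### Coextensive categories -/

section Coextensive

variable {C : Type w} [Category.{v} C] [HasFiniteProducts C]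

/-- The canonical functor `X/C × Y/C ⥤ (X × Y)/C`, sending a pair of morphisms `(f, g)` to their
product `f × g`. -/
noncomputable def underProd (X Y : C) : Under X × Under Y ⥤ Under (X ⨯ Y) where
  obj p := Under.mk (prod.map p.1.hom p.2.hom)
  map {p q} φ := Under.homMk (prod.map φ.1.right φ.2.right) (by
    simp only [Under.mk_hom, prod.map_map, Under.w])
  map_id p := by ext; all_goals simp
  map_comp φ ψ := by ext; all_goals simp

variable (C) in
/-- A category with finite products is coextensive if for all objects `X`, `Y` the canonical
functor `X/C × Y/C ⥤ (X × Y)/C` is an equivalence of categories. -/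
def IsCoextensive : Prop :=
  ∀ X Y : C, (underProd X Y).IsEquivalence

end Coextensive

/-! ### Varieties of universal algebras

A (finitary) signature is a first-order language without relation symbols. -/

/-- A variety of universal algebras of signature `L`, given by a set of identities between terms
in countably many variables. -/
structure Variety (L : FirstOrder.Language.{u, v}) where
  identities : Set (L.Term ℕ × L.Term ℕ)

namespace Variety

variable {L : FirstOrder.Language.{u, v}}

/-- An algebra (possibly empty) of the variety `V`: a set with an interpretation of the operations
that satisfies all identities of `V`. -/
structure Alg (V : Variety L) where
  carrier : Type u
  [str : L.Structure carrier]
  sat : ∀ e ∈ V.identities, ∀ x : ℕ → carrier, e.1.realize x = e.2.realize x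

instance (V : Variety L) : CoeSort V.Alg (Type u) := ⟨Alg.carrier⟩

instance (V : Variety L) (A : V.Alg) : L.Structure A := A.str

/-- The variety as a category: the morphisms are the homomorphisms. -/
instance (V : Variety L) : Category.{u} V.Alg where
  Hom A B := A →[L] B
  id A := Hom.id L A
  comp f g := Hom.comp g f

instance (V : Variety L) : ConcreteCategory V.Alg (fun A B => A →[L] B) where
  hom f := f
  ofHom f := f

variable {V : Variety L}

@[simp] theorem id_apply (A : V.Alg) (a : A) : (𝟙 A : A ⟶ A) a = a := rfl

@[simp] theorem comp_apply {A B C : V.Alg} (f : A ⟶ B) (g : B ⟶ C) (a : A) :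
    (f ≫ g) a = g (f a) := rfl

theorem alg_hom_ext {A B : V.Alg} {f g : A ⟶ B} (h : ∀ a : A, f a = g a) : f = g :=
  Hom.ext h

theorem map_funMap {A B : V.Alg} (f : A ⟶ B) {n : ℕ} (s : L.Functions n) (x : Fin n → A) :
    f (Structure.funMap s x) = Structure.funMap s (fun i => f (x i)) :=
  Hom.map_fun' f s x

theorem map_realize {A B : V.Alg} (f : A ⟶ B) {α : Type*} (t : L.Term α) (x : α → A) :
    f (t.realize x) = t.realize (fun i => f (x i)) := by
  induction t with
  | var i => rfl
  | func s ts ih => simp only [Term.realize_func, map_funMap, ih]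

variable [L.IsAlgebraic]

/-- A map preserving the operations is a homomorphism. -/
def homOf {A B : V.Alg} (f : A → B)
    (hf : ∀ {n : ℕ} (s : L.Functions n) (x : Fin n → A),
      f (Structure.funMap s x) = Structure.funMap s (fun i => f (x i))) : A ⟶ B :=
  { toFun := f
    map_fun' := hf
    map_rel' := fun r => isEmptyElim r }

@[simp] theorem homOf_apply {A B : V.Alg} (f : A → B)
    (hf : ∀ {n : ℕ} (s : L.Functions n) (x : Fin n → A),
      f (Structure.funMap s x) = Structure.funMap s (fun i => f (x i))) (a : A) :
    homOf f hf a = f a := rfl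

/-! ### Finite products -/

instance : L.Structure PUnit.{u + 1} where
  funMap _ _ := PUnit.unit

variable (V) in
/-- The one-point algebra. -/
def terminalAlg : V.Alg where
  carrier := PUnit
  sat _ _ _ := rfl

instance : HasTerminal V.Alg :=
  IsTerminal.hasTerminal (X := terminalAlg V) <|
    IsTerminal.ofUniqueHom (fun _ => homOf (fun _ => PUnit.unit) (fun _ _ => rfl))
      (fun _ _ => alg_hom_ext fun _ => rfl)

instance prodStructure (A B : V.Alg) : L.Structure (A × B) where
  funMap s x := (Structure.funMap s fun i => (x i).1, Structure.funMap s fun i => (x i).2)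

theorem realize_prod (A B : V.Alg) {α : Type*} (t : L.Term α) (x : α → A × B) :
    t.realize x = (t.realize fun i => (x i).1, t.realize fun i => (x i).2) := by
  induction t with
  | var i => rfl
  | func s ts ih => simp only [Term.realize_func, ih]; rfl

/-- The product of two algebras: the cartesian product with componentwise operations. -/
def prodAlg (A B : V.Alg) : V.Alg where
  carrier := A × B
  sat e he x := by rw [realize_prod, realize_prod, A.sat e he, B.sat e he]

def prodFan (A B : V.Alg) : BinaryFan A B :=
  BinaryFan.mk (P := prodAlg A B) (homOf Prod.fst fun _ _ => rfl) (homOf Prod.snd fun _ _ => rfl)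

def prodFanIsLimit (A B : V.Alg) : IsLimit (prodFan A B) :=
  BinaryFan.IsLimit.mk _
    (fun f g => homOf (B := prodAlg A B) (fun c => (f c, g c))
      fun s x => by rw [map_funMap, map_funMap]; rfl)
    (fun _ _ => rfl) (fun _ _ => rfl)
    (fun f g m hf hg => by subst hf hg; rfl)

instance (A B : V.Alg) : HasBinaryProduct A B := ⟨⟨_, prodFanIsLimit A B⟩⟩

instance : HasBinaryProducts V.Alg := hasBinaryProducts_of_hasLimit_pair _

instance : HasFiniteProducts V.Alg := hasFiniteProducts_of_has_binary_and_terminal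

/-! ### Algebras given by generators, free algebras, coproducts -/

/-- For a set `X` of generators and a class `P` of maps from `X` to algebras of `V`: two terms
over `X` are identified if they take the same value under every map in `P`. -/
def termSetoid (V : Variety L) (X : Type u) (P : ∀ A : V.Alg, (X → A) → Prop) :
    Setoid (L.Term X) where
  r s t := ∀ (A : V.Alg) (x : X → A), P A x → s.realize x = t.realize x
  iseqv :=
    ⟨fun _ _ _ _ => rfl, fun h A x hx => (h A x hx).symm,
      fun h h' A x hx => (h A x hx).trans (h' A x hx)⟩

section Generated

variable {X : Type u} (P : ∀ A : V.Alg, (X → A) → Prop)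

/-- Operations on the quotient of the term algebra over `X` by `termSetoid V X P`. -/
noncomputable instance termQuotientStructure : L.Structure (Quotient (termSetoid V X P)) where
  funMap s x := Quotient.mk _ (Term.func s fun i => (x i).out)

theorem funMap_mk {n : ℕ} (s : L.Functions n) (ts : Fin n → L.Term X) :
    Structure.funMap s (fun i => (Quotient.mk (termSetoid V X P) (ts i))) =
      Quotient.mk (termSetoid V X P) (Term.func s ts) :=
  Quotient.sound fun A x hx => by
    simp only [Term.realize_func]
    congr 1
    funext i
    exact Quotient.mk_out (s := termSetoid V X P) (ts i) A x hx

theorem realize_mk {α : Type*} (t : L.Term α) (ts : α → L.Term X) :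
    t.realize (fun i => (Quotient.mk (termSetoid V X P) (ts i))) =
      Quotient.mk (termSetoid V X P) (t.subst ts) := by
  induction t with
  | var i => rfl
  | func s us ih =>
    simp only [Term.realize_func, ih, funMap_mk]
    rfl

/-- The quotient of the term algebra over `X` by `termSetoid V X P`, an algebra of `V`. -/
noncomputable def genAlg : V.Alg where
  carrier := Quotient (termSetoid V X P)
  sat e he x := by
    have hx : x = fun i => Quotient.mk (termSetoid V X P) (x i).out := by
      funext i; exact (Quotient.out_eq _).symm
    rw [hx, realize_mk, realize_mk]
    refine Quotient.sound fun A y _ => ?_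
    rw [Term.realize_subst, Term.realize_subst]
    exact A.sat e he _

/-- The generator of `genAlg P` given by `x`. -/
noncomputable def gen (x : X) : genAlg P := Quotient.mk (termSetoid V X P) (Term.var x)

variable {P}

/-- Every map in the class `P` extends to a homomorphism on `genAlg P`. -/
noncomputable def genLift {A : V.Alg} (f : X → A) (hf : P A f) : genAlg P ⟶ A :=
  homOf (A := genAlg P)
    (Quotient.lift (fun t : L.Term X => t.realize f)
      fun s t h => (show (termSetoid V X P).r s t from h) A f hf) (by
      intro n s x
      have hx : x = fun i => Quotient.mk (termSetoid V X P) (x i).out := by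
        funext i; exact (Quotient.out_eq _).symm
      rw [hx]
      change Quotient.lift _ _ (Structure.funMap s
        fun i => Quotient.mk (termSetoid V X P) (x i).out) = _
      rw [funMap_mk]
      rfl)

theorem genLift_gen {A : V.Alg} (f : X → A) (hf : P A f) (x : X) :
    genLift f hf (gen P x) = f x := rfl

theorem mk_eq_realize (t : L.Term X) :
    (Quotient.mk (termSetoid V X P) t : genAlg P) = t.realize (gen P) := by
  induction t with
  | var x => rfl
  | func s ts ih =>
    rw [Term.realize_func, ← funext ih]
    exact (funMap_mk P s ts).symm

theorem gen_hom_ext {A : V.Alg} {f g : genAlg P ⟶ A} (h : ∀ x, f (gen P x) = g (gen P x)) :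
    f = g := by
  refine alg_hom_ext fun q => ?_
  induction q using Quotient.inductionOn with
  | h t => rw [mk_eq_realize, map_realize, map_realize]; simp only [h]

end Generated

/-- The free algebra `F(X)` of `V` on the set `X`: terms over `X` modulo the identities that hold
in every algebra of `V`. -/
noncomputable def free (V : Variety L) (X : Type u) : V.Alg :=
  genAlg (fun (A : V.Alg) (_ : X → A) => True)

/-- The inclusion of generators `X → F(X)`. -/
noncomputable def freeOf {X : Type u} (x : X) : V.free X := gen _ x

/-- The unique homomorphism `F(X) ⟶ A` that extends a map `X → A`. -/
noncomputable def freeLift {X : Type u} {A : V.Alg} (f : X → A) : V.free X ⟶ A :=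
  genLift f trivial

@[simp] theorem freeLift_of {X : Type u} {A : V.Alg} (f : X → A) (x : X) :
    freeLift f (freeOf x) = f x := rfl

theorem free_hom_ext {X : Type u} {A : V.Alg} {f g : V.free X ⟶ A}
    (h : ∀ x, f (freeOf x) = g (freeOf x)) : f = g :=
  gen_hom_ext h

/-- The unique homomorphism from the initial algebra `F(∅)` to `A`; its value at `e` is the value
of the constant `e` in `A`. -/
noncomputable def fromInitial (A : V.Alg) : V.free PEmpty ⟶ A :=
  freeLift PEmpty.elim

theorem fromInitial_uniq {A : V.Alg} (f : V.free PEmpty ⟶ A) : f = fromInitial A :=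
  free_hom_ext fun x => x.elim

/-- The maps out of the disjoint union of `A` and `B` that are homomorphisms on both parts. -/
def IsHomOnParts (A B : V.Alg) (C : V.Alg) (x : A ⊕ B → C) : Prop :=
  ∃ (f : A ⟶ C) (g : B ⟶ C), x = Sum.elim (fun a => f a) (fun b => g b)

noncomputable def coprodInl (A B : V.Alg) : A ⟶ genAlg (IsHomOnParts A B) :=
  homOf (fun a => gen (IsHomOnParts A B) (Sum.inl a)) (by
    intro n s x
    refine Eq.trans (Quotient.sound ?_) (funMap_mk _ s fun i => Term.var (Sum.inl (x i))).symm
    rintro C _ ⟨f, g, rfl⟩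
    exact map_funMap f s x)

noncomputable def coprodInr (A B : V.Alg) : B ⟶ genAlg (IsHomOnParts A B) :=
  homOf (fun b => gen (IsHomOnParts A B) (Sum.inr b)) (by
    intro n s x
    refine Eq.trans (Quotient.sound ?_) (funMap_mk _ s fun i => Term.var (Sum.inr (x i))).symm
    rintro C _ ⟨f, g, rfl⟩
    exact map_funMap g s x)

noncomputable def coprodCofan (A B : V.Alg) : BinaryCofan A B :=
  BinaryCofan.mk (coprodInl A B) (coprodInr A B)

noncomputable def coprodCofanIsColimit (A B : V.Alg) : IsColimit (coprodCofan A B) :=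
  BinaryCofan.IsColimit.mk _
    (fun f g => genLift (Sum.elim (fun a => f a) (fun b => g b)) ⟨f, g, rfl⟩)
    (fun _ _ => rfl) (fun _ _ => rfl)
    (fun f g m hf hg => by
      subst hf hg
      refine gen_hom_ext ?_
      rintro (a | b) <;> rfl)

instance (A B : V.Alg) : HasBinaryCoproduct A B := ⟨⟨_, coprodCofanIsColimit A B⟩⟩

instance : HasBinaryCoproducts V.Alg := hasBinaryCoproducts_of_hasColimit_pair _

/-! ### The unit component and diagonalising terms -/

/-- The component `η_X : F(X) + F(∅)² ⟶ F(X)²` of the unit, at the coproduct inclusion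
`F(∅)² ⟶ F(X) + F(∅)²`. The pushouts of that inclusion along the two projections `F(∅)² ⟶ F(∅)` are
`[id, π₁]` and `[id, π₂]`, both from `F(X) + F(∅)²` to `F(X)`, where `πᵢ` is followed by the unique
homomorphism `F(∅) ⟶ F(X)`; so the unit component is the homomorphism with these two components. -/
noncomputable def eta (V : Variety L) (X : Type u) :
    V.free X ⨿ (V.free PEmpty ⨯ V.free PEmpty) ⟶ V.free X ⨯ V.free X :=
  prod.lift
    (coprod.desc (𝟙 _) (prod.fst ≫ fromInitial (V.free X)))
    (coprod.desc (𝟙 _) (prod.snd ≫ fromInitial (V.free X)))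

/-- `V` has a diagonalising term: for some `k ≥ 1` there are a `(k + 2)`-ary term `t` and constants
`e₁, …, eₖ, e₁', …, eₖ' ∈ F(∅)` such that the identities `t(x, y, e₁, …, eₖ) = x` and
`t(x, y, e₁', …, eₖ') = y` hold in `V`. -/
def HasDiagonalisingTerm (V : Variety L) : Prop :=
  ∃ k : ℕ, 1 ≤ k ∧ ∃ (t : L.Term (Fin (k + 2))) (e e' : Fin k → V.free PEmpty),
    ∀ (A : V.Alg) (x y : A),
      t.realize (Fin.cons x (Fin.cons y fun i => fromInitial A (e i)) : Fin (k + 2) → A) = x ∧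
      t.realize (Fin.cons x (Fin.cons y fun i => fromInitial A (e' i)) : Fin (k + 2) → A) = y

end Variety

namespace Variety

variable {L : FirstOrder.Language.{u, v}} {V : Variety L}

/-! ### The operation given by a term -/

/-! `η_X` is the universal arrow from the inclusion `F(∅)² ⟶ F(X) + F(∅)²` to the product functor
(`bijective_etaUnder_comp`). If that functor is an equivalence, a universal arrow to it is
invertible.

Conversely, a homomorphism `v : F(∅)² ⟶ C` turns the term into an operation `d(x, y) = t(x, y, v(e₁,
e₁'), …)`. On a product `A × B` with its canonical `v`, `d` takes the first coordinate of `x` and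
the second of `y`. In `F(C) + F(∅)²` the two components of `η_C` see `d` as the two projections;
since `η_C` is injective, the laws of a rectangular band and commutation with the operations hold
there for generators, and they pass to `C` along the homomorphism that evaluates generators
(`isDecomposition`). So `C` splits as a product (`exists_factors`). Homomorphisms preserve `d`, so
those from `A × B` act coordinatewise: this gives fullness and essential surjectivity. -/

/-- The binary operation `x, y ↦ t(x, y, c₁, …, cₖ)`. -/
def diagOp {k : ℕ} (t : L.Term (Fin (k + 2))) {C : V.Alg} (c : Fin k → C) (x y : C) : C :=
  t.realize (Fin.cons x (Fin.cons y c) : Fin (k + 2) → C)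

theorem map_diagOp {k : ℕ} (t : L.Term (Fin (k + 2))) {C D : V.Alg} (f : C ⟶ D) (c : Fin k → C)
    (x y : C) : f (diagOp t c x y) = diagOp t (fun i => f (c i)) (f x) (f y) := by
  rw [diagOp, map_realize, diagOp]
  congr 1
  funext i
  refine Fin.cases rfl (fun i => ?_) i
  exact Fin.cases rfl (fun _ => rfl) i

section Equational

variable [L.IsAlgebraic]

/-! ### Elements of binary products -/

/-- The first projection of the cartesian product. -/
def fstHom (A B : V.Alg) : prodAlg A B ⟶ A := homOf Prod.fst fun _ _ => rfl

/-- The second projection of the cartesian product. -/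
def sndHom (A B : V.Alg) : prodAlg A B ⟶ B := homOf Prod.snd fun _ _ => rfl

theorem prod_ext {A B : V.Alg} {p q : (A ⨯ B : V.Alg)}
    (h₁ : (prod.fst : A ⨯ B ⟶ A) p = (prod.fst : A ⨯ B ⟶ A) q)
    (h₂ : (prod.snd : A ⨯ B ⟶ B) p = (prod.snd : A ⨯ B ⟶ B) q) : p = q := by
  let e : A ⨯ B ⟶ prodAlg A B := homOf
    (fun p => ((prod.fst : A ⨯ B ⟶ A) p, (prod.snd : A ⨯ B ⟶ B) p))
    fun s x => by rw [map_funMap, map_funMap]; rfl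
  -- This one-sided inverse suffices: it makes `e` injective.
  have he : e ≫ prod.lift (fstHom A B) (sndHom A B) = 𝟙 _ := by
    apply Limits.prod.hom_ext
    · rw [Category.assoc, prod.lift_fst, Category.id_comp]; rfl
    · rw [Category.assoc, prod.lift_snd, Category.id_comp]; rfl
  have hpq : e p = e q := Prod.ext h₁ h₂
  rw [← id_apply (A ⨯ B) p, ← id_apply (A ⨯ B) q, ← he, comp_apply, comp_apply, hpq]

/-- The element of the product `A ⨯ B` with components `a` and `b`. -/
noncomputable def pair {A B : V.Alg} (a : A) (b : B) : (A ⨯ B : V.Alg) :=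
  (prod.lift (fstHom A B) (sndHom A B) : prodAlg A B ⟶ A ⨯ B) (a, b)

@[simp] theorem fst_pair {A B : V.Alg} (a : A) (b : B) :
    (prod.fst : A ⨯ B ⟶ A) (pair a b) = a :=
  congrArg (fun f : prodAlg A B ⟶ A => f (a, b)) (prod.lift_fst (fstHom A B) (sndHom A B))

@[simp] theorem snd_pair {A B : V.Alg} (a : A) (b : B) :
    (prod.snd : A ⨯ B ⟶ B) (pair a b) = b :=
  congrArg (fun f : prodAlg A B ⟶ B => f (a, b)) (prod.lift_snd (fstHom A B) (sndHom A B))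

theorem isIso_of_bijective {A B : V.Alg} (f : A ⟶ B) (hf : Function.Bijective fun a => f a) :
    IsIso f := by
  let e := Equiv.ofBijective _ hf
  have he : ∀ b, f (e.symm b) = b := e.apply_symm_apply
  refine ⟨homOf e.symm fun s x => hf.1 ?_, alg_hom_ext fun a => hf.1 ?_, alg_hom_ext he⟩
  · change f _ = f _
    rw [he, map_funMap]
    simp only [he]
  · exact he _

/-- Fix `b` and send `a` to `w (a, b)`. Since `w` ignores the second coordinate, this map preserves
operations even though `b` need not be a subalgebra. -/
theorem exists_fst_comp_eq {A B C : V.Alg} [Nonempty B] (w : A ⨯ B ⟶ C)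
    (hw : ∀ p q, (prod.fst : A ⨯ B ⟶ A) p = (prod.fst : A ⨯ B ⟶ A) q → w p = w q) :
    ∃ f : A ⟶ C, prod.fst ≫ f = w := by
  obtain ⟨b⟩ := ‹Nonempty B›
  refine ⟨homOf (fun a => w (pair a b)) fun s x => ?_, alg_hom_ext fun p => hw _ _ ?_⟩
  · rw [← map_funMap]
    exact hw _ _ (by simp only [map_funMap, fst_pair])
  · exact fst_pair _ _

theorem exists_snd_comp_eq {A B C : V.Alg} [Nonempty A] (w : A ⨯ B ⟶ C)
    (hw : ∀ p q, (prod.snd : A ⨯ B ⟶ B) p = (prod.snd : A ⨯ B ⟶ B) q → w p = w q) :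
    ∃ g : B ⟶ C, prod.snd ≫ g = w := by
  obtain ⟨a⟩ := ‹Nonempty A›
  refine ⟨homOf (fun b => w (pair a b)) fun s x => ?_, alg_hom_ext fun p => hw _ _ ?_⟩
  · rw [← map_funMap]
    exact hw _ _ (by simp only [map_funMap, snd_pair])
  · exact snd_pair _ _

theorem eta_fst (X : Type u) : V.eta X ≫ prod.fst =
    coprod.desc (𝟙 _) (prod.fst ≫ fromInitial (V.free X)) :=
  prod.lift_fst _ _

theorem eta_snd (X : Type u) : V.eta X ≫ prod.snd =
    coprod.desc (𝟙 _) (prod.snd ≫ fromInitial (V.free X)) :=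
  prod.lift_snd _ _

theorem fromInitial_comp {A B : V.Alg} (f : A ⟶ B) : fromInitial A ≫ f = fromInitial B :=
  fromInitial_uniq _

end Equational

/-! ### Quotients and decomposition operations -/

/-- The prestructure given by a congruence on an algebra. -/
abbrev congruencePrestructure [L.IsAlgebraic] (C : V.Alg) (r : Setoid C)
    (hr : ∀ {n : ℕ} (s : L.Functions n) (x y : Fin n → C), (∀ i, r (x i) (y i)) →
      r (Structure.funMap s x) (Structure.funMap s y)) : L.Prestructure r where
  toStructure := C.str
  fun_equiv := fun {_} {s} x y h => hr s x y h
  rel_equiv := fun {_} {R} => isEmptyElim R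

section Equational

variable [L.IsAlgebraic]

theorem exists_quotient (C : V.Alg) (r : Setoid C)
    (hr : ∀ {n : ℕ} (s : L.Functions n) (x y : Fin n → C), (∀ i, r (x i) (y i)) →
      r (Structure.funMap s x) (Structure.funMap s y)) :
    ∃ (Q : V.Alg) (q : C ⟶ Q), (Function.Surjective fun x => q x) ∧
      ∀ x y, q x = q y ↔ r x y := by
  let := congruencePrestructure C r hr
  let Q : V.Alg :=
    { carrier := Quotient r
      sat := fun e he x => by
        have hx : x = fun i => Quotient.mk r (x i).out := by
          funext i; exact (Quotient.out_eq _).symm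
        rw [hx]
        refine (Term.realize_quotient_mk' r e.1 _).trans
          (Eq.trans ?_ (Term.realize_quotient_mk' r e.2 _).symm)
        exact congrArg _ (C.sat e he _) }
  refine ⟨Q, homOf (B := Q) (Quotient.mk r) fun s x => ?_, Quotient.mk_surjective, fun x y => ?_⟩
  · exact (funMap_quotient_mk' r s x).symm
  · exact Quotient.eq

/-- A decomposition operation on an algebra: a homomorphic rectangular band operation. -/
structure IsDecomposition (C : V.Alg) (d : C → C → C) : Prop where
  idem : ∀ x, d x x = x
  left : ∀ x y z, d (d x y) z = d x z
  right : ∀ x y z, d x (d y z) = d x z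
  hom : ∀ {n : ℕ} (s : L.Functions n) (x y : Fin n → C),
    d (Structure.funMap s x) (Structure.funMap s y) = Structure.funMap s fun i => d (x i) (y i)

/-- A decomposition operation on `C` presents `C` as a product of two quotients. -/
theorem IsDecomposition.exists_factors {C : V.Alg} {d : C → C → C} (hd : IsDecomposition C d) :
    ∃ (Q₁ Q₂ : V.Alg) (q₁ : C ⟶ Q₁) (q₂ : C ⟶ Q₂), (∀ x y, q₁ (d x y) = q₁ x) ∧
      (∀ x y, q₂ (d x y) = q₂ y) ∧ IsIso (prod.lift q₁ q₂) := by
  -- With `d` read as "first coordinate of `x`, second of `y`", `d x x' = x'` says that the first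
  -- coordinates agree, and `d x x' = x` that the second ones do. Stating each condition both ways
  -- makes symmetry immediate.
  obtain ⟨Q₁, q₁, hs₁, hq₁⟩ := exists_quotient C
    ⟨fun x x' => d x x' = x' ∧ d x' x = x, fun x => ⟨hd.idem x, hd.idem x⟩,
      fun h => ⟨h.2, h.1⟩, fun {x y z} h h' =>
        ⟨by rw [← hd.left x y z, h.1, h'.1], by rw [← hd.left z y x, h'.2, h.2]⟩⟩
    (fun s x y h => ⟨by rw [hd.hom]; simp only [(h _).1], by rw [hd.hom]; simp only [(h _).2]⟩)
  obtain ⟨Q₂, q₂, hs₂, hq₂⟩ := exists_quotient C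
    ⟨fun x x' => d x x' = x ∧ d x' x = x', fun x => ⟨hd.idem x, hd.idem x⟩,
      fun h => ⟨h.2, h.1⟩, fun {x y z} h h' =>
        ⟨by rw [← hd.right x y z, h'.1, h.1], by rw [← hd.right z y x, h.2, h'.2]⟩⟩
    (fun s x y h => ⟨by rw [hd.hom]; simp only [(h _).1], by rw [hd.hom]; simp only [(h _).2]⟩)
  have h₁ : ∀ x y, q₁ (d x y) = q₁ x := fun x y =>
    (hq₁ _ _).2 ⟨by rw [hd.left, hd.idem], by rw [hd.right]⟩
  have h₂ : ∀ x y, q₂ (d x y) = q₂ y := fun x y =>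
    (hq₂ _ _).2 ⟨by rw [hd.left], by rw [hd.right, hd.idem]⟩
  refine ⟨Q₁, Q₂, q₁, q₂, h₁, h₂, isIso_of_bijective _ ⟨fun x y hxy => ?_, fun p => ?_⟩⟩
  -- The two kernels meet trivially: they give `x = d x y = y`.
  · have e₁ : q₁ x = q₁ y := by
      rw [← prod.lift_fst q₁ q₂, comp_apply, comp_apply]; exact congrArg _ hxy
    have e₂ : q₂ x = q₂ y := by
      rw [← prod.lift_snd q₁ q₂, comp_apply, comp_apply]; exact congrArg _ hxy
    exact ((hq₂ _ _).1 e₂).1.symm.trans ((hq₁ _ _).1 e₁).1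
  · obtain ⟨x, hx⟩ := hs₁ ((prod.fst : Q₁ ⨯ Q₂ ⟶ Q₁) p)
    obtain ⟨y, hy⟩ := hs₂ ((prod.snd : Q₁ ⨯ Q₂ ⟶ Q₂) p)
    refine ⟨d x y, prod_ext ?_ ?_⟩
    · rw [← hx, ← comp_apply, prod.lift_fst]; exact h₁ x y
    · rw [← hy, ← comp_apply, prod.lift_snd]; exact h₂ x y

/-! ### Diagonalising terms -/

/-- The terms and constants `t, e, e'` form a diagonalising term. -/
def IsDiagonalising {k : ℕ} (t : L.Term (Fin (k + 2))) (e e' : Fin k → V.free PEmpty) : Prop :=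
  ∀ (A : V.Alg) (x y : A), diagOp t (fun i => fromInitial A (e i)) x y = x ∧
    diagOp t (fun i => fromInitial A (e' i)) x y = y

namespace IsDiagonalising

variable {k : ℕ} {t : L.Term (Fin (k + 2))} {e e' : Fin k → V.free PEmpty}

/-- `f` sends the parameters `v (e i, e' i)` to the constants `e i`, for which the term is the first
projection. -/
theorem map_eq_left (ht : IsDiagonalising t e e') {C A : V.Alg}
    {v : V.free PEmpty ⨯ V.free PEmpty ⟶ C} {f : C ⟶ A} (h : v ≫ f = prod.fst ≫ fromInitial A)
    (x y : C) : f (diagOp t (fun i => v (pair (e i) (e' i))) x y) = f x := by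
  rw [map_diagOp]
  simp only [← comp_apply v f, h]
  simp only [comp_apply, fst_pair]
  exact (ht A _ _).1

theorem map_eq_right (ht : IsDiagonalising t e e') {C A : V.Alg}
    {v : V.free PEmpty ⨯ V.free PEmpty ⟶ C} {f : C ⟶ A} (h : v ≫ f = prod.snd ≫ fromInitial A)
    (x y : C) : f (diagOp t (fun i => v (pair (e i) (e' i))) x y) = f y := by
  rw [map_diagOp]
  simp only [← comp_apply v f, h]
  simp only [comp_apply, snd_pair]
  exact (ht A _ _).2

/-- Already in `A ⨯ B` one has `p = d(q, p)`, because the first coordinate may be borrowed from `q`;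
then apply `u`. -/
theorem map_fst_eq (ht : IsDiagonalising t e e') {A B C : V.Alg} (u : A ⨯ B ⟶ C)
    {p q : (A ⨯ B : V.Alg)} (h : (prod.fst : A ⨯ B ⟶ A) p = (prod.fst : A ⨯ B ⟶ A) q) :
    u p = diagOp t (fun i => (prod.map (fromInitial A) (fromInitial B) ≫ u) (pair (e i) (e' i)))
      (u q) (u p) := by
  simp only [comp_apply]
  rw [← map_diagOp]
  congr 1
  refine prod_ext ?_ ?_
  · rw [ht.map_eq_left (prod.map_fst _ _), h]
  · rw [ht.map_eq_right (prod.map_snd _ _)]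

theorem map_snd_eq (ht : IsDiagonalising t e e') {A B C : V.Alg} (u : A ⨯ B ⟶ C)
    {p q : (A ⨯ B : V.Alg)} (h : (prod.snd : A ⨯ B ⟶ B) p = (prod.snd : A ⨯ B ⟶ B) q) :
    u p = diagOp t (fun i => (prod.map (fromInitial A) (fromInitial B) ≫ u) (pair (e i) (e' i)))
      (u p) (u q) := by
  simp only [comp_apply]
  rw [← map_diagOp]
  congr 1
  refine prod_ext ?_ ?_
  · rw [ht.map_eq_left (prod.map_fst _ _)]
  · rw [ht.map_eq_right (prod.map_snd _ _), h]

/-- If `η_X` is a monomorphism for the underlying set `X` of `C`, then a diagonalising term makes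
every homomorphism `F(∅)² ⟶ C` into a decomposition operation on `C`. -/
theorem isDecomposition (ht : IsDiagonalising t e e') {C : V.Alg} (hη : IsIso (V.eta C))
    (v : V.free PEmpty ⨯ V.free PEmpty ⟶ C) :
    IsDecomposition C (diagOp t fun i => v (pair (e i) (e' i))) := by
  let P : V.Alg := V.free C ⨿ (V.free PEmpty ⨯ V.free PEmpty)
  let w : V.free PEmpty ⨯ V.free PEmpty ⟶ P := coprod.inr
  -- `ψ` evaluates the generators `g x` back to `x` and carries `d` to the operation on `C`.
  let ψ : P ⟶ C := coprod.desc (freeLift id) v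
  let g : C → P := fun x => (coprod.inl : V.free C ⟶ P) (freeOf x)
  let d : P → P → P := diagOp t fun i => w (pair (e i) (e' i))
  let f₁ : P ⟶ V.free C := coprod.desc (𝟙 _) (prod.fst ≫ fromInitial _)
  let f₂ : P ⟶ V.free C := coprod.desc (𝟙 _) (prod.snd ≫ fromInitial _)
  have inj : ∀ p q : P, f₁ p = f₁ q → f₂ p = f₂ q → p = q := fun p q h₁ h₂ => by
    have h : V.eta C p = V.eta C q := by
      refine prod_ext ?_ ?_
      · rw [← comp_apply, ← comp_apply, eta_fst]; exact h₁
      · rw [← comp_apply, ← comp_apply, eta_snd]; exact h₂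
    have := congrArg (fun z => inv (V.eta C) z) h
    simpa only [← comp_apply, IsIso.hom_inv_id, id_apply] using this
  have hg : ∀ x, ψ (g x) = x := fun x => by
    simp only [g, ψ]
    rw [← comp_apply, coprod.inl_desc, freeLift_of]; rfl
  have hd : ∀ p q, ψ (d p q) = diagOp t (fun i => v (pair (e i) (e' i))) (ψ p) (ψ q) :=
    fun p q => by
      simp only [d]
      rw [map_diagOp]
      simp only [← comp_apply w ψ, w, ψ, coprod.inr_desc]
  have d₁ : ∀ p q, f₁ (d p q) = f₁ p := ht.map_eq_left (coprod.inr_desc _ _)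
  have d₂ : ∀ p q, f₂ (d p q) = f₂ q := ht.map_eq_right (coprod.inr_desc _ _)
  -- Each law is checked on generators in `P` through `f₁` and `f₂`, then pushed along `ψ`.
  refine ⟨fun x => ?_, fun x y z => ?_, fun x y z => ?_, fun s x y => ?_⟩
  · have := congrArg (fun p => ψ p) (inj (d (g x) (g x)) (g x) (d₁ _ _) (d₂ _ _))
    simpa only [hd, hg] using this
  · have := congrArg (fun p => ψ p) (inj (d (d (g x) (g y)) (g z)) (d (g x) (g z))
      (by simp only [d₁]) (by simp only [d₂]))
    simpa only [hd, hg] using this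
  · have := congrArg (fun p => ψ p) (inj (d (g x) (d (g y) (g z))) (d (g x) (g z))
      (by simp only [d₁]) (by simp only [d₂]))
    simpa only [hd, hg] using this
  · have := congrArg (fun p => ψ p) (inj
      (d (Structure.funMap s fun i => g (x i)) (Structure.funMap s fun i => g (y i)))
      (Structure.funMap s fun i => d (g (x i)) (g (y i)))
      (by simp only [d₁, map_funMap]) (by simp only [d₂, map_funMap]))
    simpa only [hd, hg, map_funMap] using this

end IsDiagonalising

/-! ### The functor `underProd` is faithful, full and essentially surjective -/

theorem fst_surjective {A B : V.Alg} [Nonempty B] :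
    Function.Surjective fun p => (prod.fst : A ⨯ B ⟶ A) p :=
  fun a => ⟨pair a (Classical.arbitrary B), fst_pair _ _⟩

theorem snd_surjective {A B : V.Alg} [Nonempty A] :
    Function.Surjective fun p => (prod.snd : A ⨯ B ⟶ B) p :=
  fun b => ⟨pair (Classical.arbitrary A) b, snd_pair _ _⟩

theorem faithful_underProd (hV : ∀ A : V.Alg, Nonempty A) (A B : V.Alg) :
    (underProd A B).Faithful where
  map_injective {p q φ ψ} h := by
    have h' : prod.map φ.1.right φ.2.right = prod.map ψ.1.right ψ.2.right :=
      congrArg (fun m => CommaMorphism.right m) h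
    have hp₁ := hV p.1.right
    have hp₂ := hV p.2.right
    refine Prod.ext (Under.UnderMorphism.ext (alg_hom_ext fun a => ?_))
      (Under.UnderMorphism.ext (alg_hom_ext fun b => ?_))
    · obtain ⟨x, rfl⟩ := fst_surjective (A := p.1.right) (B := p.2.right) a
      have := congrArg (fun m => m ≫ prod.fst) h'
      simp only [prod.map_fst] at this
      simp only [← comp_apply, this]
    · obtain ⟨x, rfl⟩ := snd_surjective (A := p.1.right) (B := p.2.right) b
      have := congrArg (fun m => m ≫ prod.snd) h'
      simp only [prod.map_snd] at this
      simp only [← comp_apply, this]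

section

variable {k : ℕ} {t : L.Term (Fin (k + 2))} {e e' : Fin k → V.free PEmpty}

/-- A morphism under `A ⨯ B` respects the canonical maps from `F(∅)²`, hence the operations `d`, so
each component of its value depends on one coordinate only. -/
theorem IsDiagonalising.full_underProd (ht : IsDiagonalising t e e')
    (hV : ∀ A : V.Alg, Nonempty A) (A B : V.Alg) : (underProd A B).Full where
  map_surjective {p q} h := by
    have hp₁ := hV p.1.right
    have hp₂ := hV p.2.right
    have hA := hV A
    have hB := hV B
    let u : p.1.right ⨯ p.2.right ⟶ q.1.right ⨯ q.2.right := h.right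
    have hu : prod.map p.1.hom p.2.hom ≫ u = prod.map q.1.hom q.2.hom := Under.w h
    have hv : prod.map (fromInitial p.1.right) (fromInitial p.2.right) ≫ u =
        prod.map (fromInitial q.1.right) (fromInitial q.2.right) := by
      rw [← fromInitial_comp p.1.hom, ← fromInitial_comp p.2.hom, ← prod.map_map,
        Category.assoc, hu, prod.map_map, fromInitial_comp, fromInitial_comp]
    obtain ⟨f, hf⟩ := exists_fst_comp_eq (u ≫ prod.fst) fun x y hxy => by
      rw [comp_apply, comp_apply, ht.map_fst_eq u hxy, hv, ht.map_eq_left (prod.map_fst _ _)]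
    obtain ⟨g, hg⟩ := exists_snd_comp_eq (u ≫ prod.snd) fun x y hxy => by
      rw [comp_apply, comp_apply, ht.map_snd_eq u hxy, hv, ht.map_eq_right (prod.map_snd _ _)]
    -- The projections of `A ⨯ B` are surjective, so the triangle may be tested after composing with
    -- them.
    have wf : p.1.hom ≫ f = q.1.hom := alg_hom_ext fun a => by
      obtain ⟨x, rfl⟩ := fst_surjective (A := A) (B := B) a
      have : (prod.map p.1.hom p.2.hom ≫ prod.fst) ≫ f = prod.fst ≫ q.1.hom := by
        rw [Category.assoc, hf, ← Category.assoc, hu, prod.map_fst]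
      rw [prod.map_fst, Category.assoc] at this
      simpa only [comp_apply] using congrArg (fun m : (A ⨯ B : V.Alg) ⟶ _ => m x) this
    have wg : p.2.hom ≫ g = q.2.hom := alg_hom_ext fun b => by
      obtain ⟨x, rfl⟩ := snd_surjective (A := A) (B := B) b
      have : (prod.map p.1.hom p.2.hom ≫ prod.snd) ≫ g = prod.snd ≫ q.2.hom := by
        rw [Category.assoc, hg, ← Category.assoc, hu, prod.map_snd]
      rw [prod.map_snd, Category.assoc] at this
      simpa only [comp_apply] using congrArg (fun m : (A ⨯ B : V.Alg) ⟶ _ => m x) this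
    refine ⟨(Under.homMk f wf, Under.homMk g wg), Under.UnderMorphism.ext ?_⟩
    change prod.map f g = u
    apply Limits.prod.hom_ext
    · rw [prod.map_fst, hf]
    · rw [prod.map_snd, hg]

/-- The constants of `A ⨯ B` induce a decomposition of the codomain of `u`, and `map_fst_eq`,
`map_snd_eq` show that `u` splits accordingly. -/
theorem IsDiagonalising.essSurj_underProd (ht : IsDiagonalising t e e')
    (hV : ∀ A : V.Alg, Nonempty A) (hη : ∀ X : Type u, IsIso (V.eta X)) (A B : V.Alg) :
    (underProd A B).EssSurj where
  mem_essImage Y := by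
    have hA := hV A
    have hB := hV B
    let u : A ⨯ B ⟶ Y.right := Y.hom
    obtain ⟨Q₁, Q₂, q₁, q₂, h₁, h₂, hq⟩ := (ht.isDecomposition (hη Y.right)
      (prod.map (fromInitial A) (fromInitial B) ≫ u)).exists_factors
    obtain ⟨f, hf⟩ := exists_fst_comp_eq (u ≫ q₁) fun x y hxy => by
      rw [comp_apply, comp_apply, ht.map_fst_eq u hxy, h₁]
    obtain ⟨g, hg⟩ := exists_snd_comp_eq (u ≫ q₂) fun x y hxy => by
      rw [comp_apply, comp_apply, ht.map_snd_eq u hxy, h₂]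
    refine ⟨(Under.mk f, Under.mk g), ⟨(Under.isoMk (asIso (prod.lift q₁ q₂) : Y.right ≅ Q₁ ⨯ Q₂) ?_).symm⟩⟩
    change u ≫ prod.lift q₁ q₂ = prod.map f g
    apply Limits.prod.hom_ext
    · rw [Category.assoc, prod.lift_fst, prod.map_fst, hf]
    · rw [Category.assoc, prod.lift_snd, prod.map_snd, hg]

end

/-! ### The unit in a coextensive variety -/

/-- The coproduct inclusion `F(∅)² ⟶ F(X) + F(∅)²`. -/
noncomputable def etaSource (V : Variety L) (X : Type u) :
    Under (V.free PEmpty ⨯ V.free PEmpty) :=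
  Under.mk (coprod.inr : _ ⟶ V.free X ⨿ (V.free PEmpty ⨯ V.free PEmpty))

/-- The unit component `η_X` as a morphism under `F(∅)²`. -/
noncomputable def etaUnder (V : Variety L) (X : Type u) :
    etaSource V X ⟶
      (underProd (V.free PEmpty) (V.free PEmpty)).obj
        (Under.mk (fromInitial (V.free X)), Under.mk (fromInitial (V.free X))) :=
  Under.homMk (V.eta X) (by
    change coprod.inr ≫ V.eta X = prod.map (fromInitial _) (fromInitial _)
    apply Limits.prod.hom_ext
    · rw [Category.assoc, eta_fst, coprod.inr_desc, prod.map_fst]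
    · rw [Category.assoc, eta_snd, coprod.inr_desc, prod.map_snd])

/-- The universal property of `η_X` as a unit component. -/
theorem bijective_etaUnder_comp (X : Type u)
    (Z : Under (V.free PEmpty) × Under (V.free PEmpty)) :
    Function.Bijective fun z : (Under.mk (fromInitial (V.free X)),
      Under.mk (fromInitial (V.free X))) ⟶ Z => etaUnder V X ≫ (underProd _ _).map z := by
  constructor
  · intro x y h
    have h' : V.eta X ≫ prod.map x.1.right x.2.right = V.eta X ≫ prod.map y.1.right y.2.right :=
      congrArg (fun m => CommaMorphism.right m) h
    -- `η_X` restricted to `F(X)` is the diagonal, so this recovers the two components.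
    have h₁ := congrArg (fun m => coprod.inl ≫ m ≫ prod.fst) h'
    have h₂ := congrArg (fun m => coprod.inl ≫ m ≫ prod.snd) h'
    simp only [Category.assoc, prod.map_fst, prod.map_snd] at h₁ h₂
    simp only [← Category.assoc (V.eta X), eta_fst, eta_snd, ← Category.assoc coprod.inl,
      coprod.inl_desc, Category.id_comp] at h₁ h₂
    exact Prod.ext (Under.UnderMorphism.ext h₁) (Under.UnderMorphism.ext h₂)
  · intro m
    let n : V.free X ⨿ (V.free PEmpty ⨯ V.free PEmpty) ⟶ Z.1.right ⨯ Z.2.right := m.right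
    have hn : coprod.inr ≫ n = prod.map Z.1.hom Z.2.hom := Under.w m
    refine ⟨(Under.homMk (coprod.inl ≫ n ≫ prod.fst) ?_,
      Under.homMk (coprod.inl ≫ n ≫ prod.snd) ?_), Under.UnderMorphism.ext ?_⟩
    · exact (fromInitial_uniq _).trans (fromInitial_uniq _).symm
    · exact (fromInitial_uniq _).trans (fromInitial_uniq _).symm
    change V.eta X ≫ prod.map (coprod.inl ≫ n ≫ prod.fst) (coprod.inl ≫ n ≫ prod.snd) = n
    have i₁ : fromInitial (V.free X) ≫ coprod.inl ≫ n ≫ prod.fst = Z.1.hom :=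
      (fromInitial_uniq _).trans (fromInitial_uniq _).symm
    have i₂ : fromInitial (V.free X) ≫ coprod.inl ≫ n ≫ prod.snd = Z.2.hom :=
      (fromInitial_uniq _).trans (fromInitial_uniq _).symm
    apply Limits.prod.hom_ext
    · rw [Category.assoc, prod.map_fst, ← Category.assoc, eta_fst]
      apply coprod.hom_ext
      · rw [coprod.inl_desc_assoc, Category.id_comp]
      · rw [coprod.inr_desc_assoc, Category.assoc, i₁, ← Category.assoc coprod.inr, hn,
          prod.map_fst]
    · rw [Category.assoc, prod.map_snd, ← Category.assoc, eta_snd]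
      apply coprod.hom_ext
      · rw [coprod.inl_desc_assoc, Category.id_comp]
      · rw [coprod.inr_desc_assoc, Category.assoc, i₂, ← Category.assoc coprod.inr, hn,
          prod.map_snd]

theorem isIso_eta_of_isCoextensive (h : IsCoextensive V.Alg) (X : Type u) : IsIso (V.eta X) := by
  have := h (V.free PEmpty) (V.free PEmpty)
  let U := underProd (V.free PEmpty) (V.free PEmpty)
  let φ := U.objObjPreimageIso (etaSource V X)
  obtain ⟨g, hg⟩ := U.map_surjective (φ.hom ≫ etaUnder V X)
  have hgi : IsIso g := by
    -- By Yoneda: the universal property of `η_X`, transported along the fully faithful `U`, makes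
    -- precomposition with `g` bijective.
    rw [isIso_iff_coyoneda_map_bijective]
    intro Z
    have : (fun x : _ ⟶ Z => U.map (g ≫ x)) =
        (fun m : _ ⟶ U.obj Z => φ.hom ≫ m) ∘ fun z => etaUnder V X ≫ U.map z := by
      funext x
      rw [Function.comp_apply, U.map_comp, hg, Category.assoc]
    refine (Function.Bijective.of_comp_iff' (f := fun y => U.map y)
      ⟨U.map_injective, U.map_surjective⟩ _).1 ?_
    change Function.Bijective (fun x => U.map (g ≫ x))
    rw [this]
    exact ((Iso.homFromEquiv φ.symm).bijective).comp (bijective_etaUnder_comp X Z)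
  have hη : IsIso (etaUnder V X) := by
    have : etaUnder V X = φ.inv ≫ U.map g := by rw [hg, Iso.inv_hom_id_assoc]
    rw [this]
    infer_instance
  exact inferInstanceAs (IsIso ((Under.forget _).map (etaUnder V X)))

end Equational

end Variety

theorem proposition2p4 {L : FirstOrder.Language.{u, v}} [L.IsAlgebraic] (V : Variety L)
    (hV : V.HasDiagonalisingTerm) :
    IsCoextensive V.Alg ↔ ∀ X : Type u, IsIso (V.eta X) := by
  refine ⟨fun h => Variety.isIso_eta_of_isCoextensive h, fun hη A B => ?_⟩
  obtain ⟨k, hk, t, e, e', ht⟩ := hV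
  -- As `k ≥ 1`, there is a constant, so no algebra is empty.
  have hne : ∀ A : V.Alg, Nonempty A := fun A => ⟨Variety.fromInitial A (e ⟨0, hk⟩)⟩
  have hd : Variety.IsDiagonalising t e e' := ht
  exact { faithful := Variety.faithful_underProd hne A B
          full := hd.full_underProd hne A B
          essSurj := hd.essSurj_underProd hne hη A B }
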